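/- Let $d\ge 2$ and let $G$ be the group of all isometries (if $d=2$), respectively of orientation preserving isometries (if $d\ge 3$), of hyperbolic $d$-space $X$, realised as a group of Lorentz matrices acting on the upper sheet of the hyperboloid in $\mathbb R^{d,1}$, with Lie algebra $\mathfrak g_{\mathbb R}=\mathfrak{so}(d,1)$. Let $K$ be the stabiliser of the base point $(0,\dots,0,1)$. Let $\mathfrak a_{\mathbb R}=\mathbb R H_1\subset\mathfrak g_{\mathbb R}$ be the line spanned by the infinitesimal unit-speed translation $H_1$ along a geodesic through the base point, $A=\exp(\mathfrak a_{\mathbb R})$, $M$ the centraliser of $A$ in $K$, $\mathfrak n_{\mathbb R}=\{Y\in\mathfrak g_{\mathbb R}:[H_1,Y]=Y\}$, $N=\exp(\mathfrak n_{\mathbb R})$ and $P=MAN$. Let $\mathfrak a^*$ be the space of $\mathbb R$-linear maps $\lambda:\mathfrak a_{\mathbb R}\to\mathbb C$, put $a^\lambda=e^{\lambda(\log a)}$ for $a\in A$, and let $\rho\in\mathfrak a^*$ be given by $a^{2\rho}=\det(\mathrm{Ad}(a)|_{\mathfrak n_{\mathbb R}})$. Real functionals on $\mathfrak a_{\mathbb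 R}$ are ordered so that $t\rho>0\Leftrightarrow t>0$. Let $\gamma\in G$ be hyperbolic, i.e. conjugate in $G$ to $a_\gamma m_\gamma$ with $a_\gamma\in A$, $a_\gamma\neq 1$, $m_\gamma\in M$, and let $\lambda_\gamma\in\mathfrak a^*$ be the element with $\lambda_\gamma(\log a_\gamma)=2\pi i$. Let $w_0\in K$ represent the non-trivial element of the Weyl group $N_K(A)/Z_K(A)$ and let $n_0\in N$, $n_0\ne 1$. Let $(\sigma,V_\sigma)$ be a finite dimensional irreducible continuous complex representation of $M$ and let $\lambda\in\mathfrak a^*$ with $\mathrm{Re}(\lambda)>-\rho$. Let $V_{\sigma,\lambda}^\infty$ be the space of smooth functions $f:G\to V_\sigma$ with $f(manx)=a^{\lambda+\rho}\sigma(m)f(x)$ for all $m\in M$, $a\in A$, $n\in N$, $x\in G$, on which $G$ acts by right translation, and let $(V_{\sigma,\lambda}^\infty)^M$ be its subspace of $M$-invariants. Then for every $l\in V_\sigma^*$ and every $f\in (V_{\sigma,\lambda}^\infty)^M$ the integrals $$I_{k,l}^{\sigma,\lambda}(f)=\int_A l(f(w_0n_0a))\,a^{-k\lambda_\gamma}\,da=\int_{\mathbb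 R} l\big(f(w_0n_0\exp(tH_1))\big)\,e^{-k\lambda_\gamma(tH_1)}\,dt\qquad(k\in\mathbb Z)$$ converge absolutely, and the sequence $\big(I_{k,l}^{\sigma,\lambda}(f)\big)_{k\in\mathbb Z}$ is rapidly decreasing: for every $N\in\mathbb N$ one has $|I_{k,l}^{\sigma,\lambda}(f)|=O(|k|^{-N})$ as $|k|\to\infty$. -/

import Mathlib

open scoped Matrix ContDiff

noncomputable section

namespace HypFourier

lemma exp_semiconj {n : Type*} [Fintype n] [DecidableEq n] {Y P Q : Matrix n n ℝ}
    (h : SemiconjBy Y P Q) : NormedSpace.exp Q * Y = Y * NormedSpace.exp P := by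
  open scoped Matrix.Norms.Operator in
  exact h.exp_right.symm

attribute [local instance] Matrix.normedAddCommGroup Matrix.normedSpace

/-- Real square matrices of size `d + 1`; the last index is the time-like one. -/
abbrev Mat (d : ℕ) := Matrix (Fin d ⊕ Unit) (Fin d ⊕ Unit) ℝ

/-- The matrix `diag(1, …, 1, -1)` of the Lorentz form. -/
abbrev J (d : ℕ) : Mat d := LieAlgebra.Orthogonal.indefiniteDiagonal (Fin d) Unit ℝ

lemma J_mul_J (d : ℕ) : J d * J d = 1 := by
  rw [J, LieAlgebra.Orthogonal.indefiniteDiagonal, Matrix.diagonal_mul_diagonal,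
    ← Matrix.diagonal_one]
  congr 1
  ext i
  rcases i with i | i <;> simp

lemma J_transpose (d : ℕ) : (J d)ᵀ = J d := by
  simp [J, LieAlgebra.Orthogonal.indefiniteDiagonal]

lemma lorentz_transpose {d : ℕ} {g : Mat d} (hg : gᵀ * J d * g = J d) :
    g * J d * gᵀ = J d := by
  have h1 : (J d * gᵀ * J d) * g = 1 := by
    rw [Matrix.mul_assoc, Matrix.mul_assoc, ← Matrix.mul_assoc gᵀ, hg, J_mul_J]
  have h2 : g * (J d * gᵀ * J d) = 1 := mul_eq_one_comm.mp h1
  calc g * J d * gᵀ = (g * (J d * gᵀ * J d)) * J d := by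
        simp only [Matrix.mul_assoc, J_mul_J, Matrix.mul_one]
    _ = J d := by rw [h2, Matrix.one_mul]

lemma lorentz_col {d : ℕ} {g : Mat d} (hg : gᵀ * J d * g = J d) :
    ∑ i, g (Sum.inl i) (Sum.inr ()) ^ 2 = g (Sum.inr ()) (Sum.inr ()) ^ 2 - 1 := by
  have h := congrFun (congrFun hg (Sum.inr ())) (Sum.inr ())
  simp [J, LieAlgebra.Orthogonal.indefiniteDiagonal, Matrix.mul_apply,
    Matrix.diagonal_apply] at h
  have h3 : ∀ i, g (Sum.inl i) (Sum.inr ()) ^ 2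
      = g (Sum.inl i) (Sum.inr ()) * g (Sum.inl i) (Sum.inr ()) := fun i => pow_two _
  simp only [h3]
  linarith [h]

lemma lorentz_time_mul {d : ℕ} {g h : Mat d} (hg : gᵀ * J d * g = J d)
    (hh : hᵀ * J d * h = J d)
    (pos : 0 < g (Sum.inr ()) (Sum.inr ()) * h (Sum.inr ()) (Sum.inr ())) :
    0 < (g * h) (Sum.inr ()) (Sum.inr ()) := by
  have hg' : gᵀᵀ * J d * gᵀ = J d := by
    rw [Matrix.transpose_transpose]; exact lorentz_transpose hg
  have e1 := lorentz_col hg'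
  have e2 := lorentz_col hh
  simp only [Matrix.transpose_apply] at e1
  have cs := Finset.sum_mul_sq_le_sq_mul_sq Finset.univ
    (fun i => g (Sum.inr ()) (Sum.inl i)) (fun i => h (Sum.inl i) (Sum.inr ()))
  rw [e1, e2] at cs
  have n1 : 0 ≤ g (Sum.inr ()) (Sum.inr ()) ^ 2 - 1 := e1 ▸ Finset.sum_nonneg fun i _ => sq_nonneg _
  have n2 : 0 ≤ h (Sum.inr ()) (Sum.inr ()) ^ 2 - 1 := e2 ▸ Finset.sum_nonneg fun i _ => sq_nonneg _
  rw [Matrix.mul_apply, Fintype.sum_sum_type]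
  simp only [Finset.univ_unique, PUnit.default_eq_unit, Finset.sum_singleton]
  nlinarith

lemma lorentz_mul {d : ℕ} {g h : Mat d} (hg : gᵀ * J d * g = J d)
    (hh : hᵀ * J d * h = J d) : (g * h)ᵀ * J d * (g * h) = J d := by
  rw [Matrix.transpose_mul]
  calc hᵀ * gᵀ * J d * (g * h) = hᵀ * (gᵀ * J d * g) * h := by simp only [Matrix.mul_assoc]
    _ = J d := by rw [hg, hh]

lemma lorentz_inv {d : ℕ} (g : GL (Fin d ⊕ Unit) ℝ) (hg : (g : Mat d)ᵀ * J d * g = J d) :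
    ((g⁻¹ : GL (Fin d ⊕ Unit) ℝ) : Mat d) = J d * (g : Mat d)ᵀ * J d := by
  have h1 : (J d * (g : Mat d)ᵀ * J d) * g = 1 := by
    rw [Matrix.mul_assoc, Matrix.mul_assoc, ← Matrix.mul_assoc (g : Mat d)ᵀ, hg, J_mul_J]
  exact ((Units.eq_inv_of_mul_eq_one_right h1).symm)

/-- The group `G` acting on hyperbolic `d`-space (the upper sheet of the hyperboloid): all
isometries if `d = 2`, and the orientation preserving ones, i.e. `SO(d,1)⁰`, otherwise. -/
def G (d : ℕ) : Subgroup (GL (Fin d ⊕ Unit) ℝ) where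
  carrier := {g | (g : Mat d)ᵀ * J d * g = J d ∧ 0 < (g : Mat d) (Sum.inr ()) (Sum.inr ()) ∧
    (d = 2 ∨ (g : Mat d).det = 1)}
  mul_mem' := by
    rintro g h ⟨hg, pg, dg⟩ ⟨hh, ph, dh⟩
    refine ⟨?_, ?_, ?_⟩
    · rw [Units.val_mul]; exact lorentz_mul hg hh
    · rw [Units.val_mul]; exact lorentz_time_mul hg hh (mul_pos pg ph)
    · rcases dg with dg | dg
      · exact Or.inl dg
      rcases dh with dh | dh
      · exact Or.inl dh
      · right; rw [Units.val_mul, Matrix.det_mul, dg, dh, one_mul]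
  one_mem' := by
    refine ⟨by simp, by simp, by simp⟩
  inv_mem' := by
    rintro g ⟨hg, pg, dg⟩
    have hi := lorentz_inv g hg
    refine ⟨?_, ?_, ?_⟩
    · rw [hi]
      have := lorentz_transpose hg
      simp only [Matrix.transpose_mul, Matrix.transpose_transpose, J_transpose]
      calc J d * ((g : Mat d) * J d) * J d * (J d * (g : Mat d)ᵀ * J d)
          = J d * ((g : Mat d) * ((J d * (J d * J d)) * (g : Mat d)ᵀ)) * J d := by
            simp only [Matrix.mul_assoc]
        _ = J d * ((g : Mat d) * J d * (g : Mat d)ᵀ) * J d := by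
            rw [J_mul_J, Matrix.mul_one, Matrix.mul_assoc (g : Mat d)]
        _ = J d := by rw [this, J_mul_J, Matrix.one_mul]
    · rw [hi]
      simpa [J, LieAlgebra.Orthogonal.indefiniteDiagonal] using pg
    · rcases dg with dg | dg
      · exact Or.inl dg
      · right
        have h1 : ((g⁻¹ * g : GL (Fin d ⊕ Unit) ℝ) : Mat d).det = 1 := by simp
        rw [Units.val_mul, Matrix.det_mul, dg, mul_one] at h1
        exact h1

instance (d : ℕ) : CoeOut (G d) (Mat d) := ⟨fun g => ((g : GL (Fin d ⊕ Unit) ℝ) : Mat d)⟩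

/-- The real Lie algebra `𝔰𝔬(d,1)` of `G`. -/
abbrev lieG (d : ℕ) : Submodule ℝ (Mat d) := skewAdjointMatricesSubmodule (J d)

lemma mem_lieG {d : ℕ} {X : Mat d} : X ∈ lieG d ↔ Xᵀ * J d = J d * (-X) := by
  rw [lieG, mem_skewAdjointMatricesSubmodule]
  rfl

lemma exp_lorentz {d : ℕ} {X : Mat d} (hX : X ∈ lieG d) :
    (NormedSpace.exp X)ᵀ * J d * NormedSpace.exp X = J d := by
  have hJ : IsUnit (J d) := IsUnit.of_mul_eq_one _ (J_mul_J d)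
  have hJi : (J d)⁻¹ = J d := Matrix.inv_eq_right_inv (J_mul_J d)
  have h1 : Xᵀ = J d * (-X) * (J d)⁻¹ := by
    rw [← mem_lieG.mp hX, hJi, Matrix.mul_assoc, J_mul_J, Matrix.mul_one]
  rw [← Matrix.exp_transpose, h1, Matrix.exp_conj _ _ hJ, hJi,
    Matrix.mul_assoc (J d * NormedSpace.exp (-X)), J_mul_J, Matrix.mul_one, Matrix.mul_assoc,
    ← Matrix.exp_add_of_commute _ _ (by simp)]
  simp

lemma exp_half {d : ℕ} (X : Mat d) :
    NormedSpace.exp X = NormedSpace.exp ((1 / 2 : ℝ) • X) * NormedSpace.exp ((1 / 2 : ℝ) • X) := by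
  rw [← Matrix.exp_add_of_commute _ _ (Commute.refl _), ← add_smul]
  norm_num

lemma lorentz_time_ne {d : ℕ} {g : Mat d} (hg : gᵀ * J d * g = J d) :
    g (Sum.inr ()) (Sum.inr ()) ≠ 0 := by
  intro h0
  have e := lorentz_col hg
  have : 0 ≤ g (Sum.inr ()) (Sum.inr ()) ^ 2 - 1 :=
    e ▸ Finset.sum_nonneg fun i _ => sq_nonneg _
  rw [h0] at this
  norm_num at this

lemma lorentz_det_sq {d : ℕ} {g : Mat d} (hg : gᵀ * J d * g = J d) : g.det * g.det = 1 := by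
  have h := congrArg Matrix.det hg
  have hJ : (J d).det * (J d).det = 1 := by rw [← Matrix.det_mul, J_mul_J, Matrix.det_one]
  have hJ0 : (J d).det ≠ 0 := by
    intro h0
    rw [h0, mul_zero] at hJ
    exact zero_ne_one hJ
  rw [Matrix.det_mul, Matrix.det_mul, Matrix.det_transpose] at h
  apply mul_left_cancel₀ hJ0
  linarith

/-- The exponential map from the Lie algebra of `G` to `G`. -/
def expG {d : ℕ} (X : lieG d) : G d :=
  ⟨⟨NormedSpace.exp (X : Mat d), NormedSpace.exp (-(X : Mat d)),
      by rw [← Matrix.exp_add_of_commute _ _ (by simp)]; simp,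
      by rw [← Matrix.exp_add_of_commute _ _ (by simp)]; simp⟩, by
    have hh : ((1 / 2 : ℝ) • (X : Mat d)) ∈ lieG d := (lieG d).smul_mem _ X.2
    have hE := exp_lorentz hh
    refine ⟨exp_lorentz X.2, ?_, Or.inr ?_⟩
    · show 0 < (NormedSpace.exp (X : Mat d)) _ _
      rw [exp_half]
      exact lorentz_time_mul hE hE (mul_self_pos.mpr (lorentz_time_ne hE))
    · show (NormedSpace.exp (X : Mat d)).det = 1
      rw [exp_half, Matrix.det_mul]
      exact lorentz_det_sq hE⟩

/-- The stabiliser `K` in `G` of the base point `(0, …, 0, 1)` of hyperbolic space. -/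
def K (d : ℕ) : Subgroup (G d) where
  carrier := {g | (g : Mat d) *ᵥ Pi.single (Sum.inr ()) 1 = Pi.single (Sum.inr ()) 1}
  mul_mem' := by
    intro g h hg hh
    simp only [Set.mem_ofPred_eq, Subgroup.coe_mul, Units.val_mul] at *
    rw [← Matrix.mulVec_mulVec, hh, hg]
  one_mem' := Matrix.one_mulVec _
  inv_mem' := by
    intro g hg
    simp only [Set.mem_ofPred_eq] at *
    conv_lhs => rw [← hg]
    rw [Matrix.mulVec_mulVec, ← Units.val_mul, ← Subgroup.coe_mul, inv_mul_cancel]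
    exact Matrix.one_mulVec _

/-- The element `H₁` of `𝔭` determined by the vector `u`: the infinitesimal translation along the
geodesic through the base point with direction `u`. -/
def H {d : ℕ} (u : Fin d → ℝ) : Mat d :=
  Matrix.fromBlocks 0 (Matrix.replicateCol Unit u) (Matrix.replicateRow Unit u) 0

lemma H_mem {d : ℕ} (u : Fin d → ℝ) : H u ∈ lieG d := by
  rw [mem_lieG]
  ext i j
  rcases i with i | i <;> rcases j with j | j <;>
  simp [H, J, LieAlgebra.Orthogonal.indefiniteDiagonal]

/-- `𝔞 = ℝ H₁`. -/
def lieA {d : ℕ} (u : Fin d → ℝ) : Submodule ℝ (Mat d) := ℝ ∙ H u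

lemma lieA_le {d : ℕ} (u : Fin d → ℝ) {X : Mat d} (hX : X ∈ lieA u) : X ∈ lieG d := by
  obtain ⟨c, rfl⟩ := Submodule.mem_span_singleton.mp hX
  exact (lieG d).smul_mem c (H_mem u)

/-- `exp : 𝔞 → G`. -/
def expA {d : ℕ} {u : Fin d → ℝ} (X : lieA u) : G d := expG ⟨X, lieA_le u X.2⟩

/-- The generator `H₁` as an element of `𝔞`. -/
def H₁ {d : ℕ} (u : Fin d → ℝ) : lieA u := ⟨H u, Submodule.mem_span_singleton_self _⟩

lemma lieA_commute {d : ℕ} {u : Fin d → ℝ} (X Y : lieA u) : Commute (X : Mat d) (Y : Mat d) := by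
  obtain ⟨c, hc⟩ := Submodule.mem_span_singleton.mp X.2
  obtain ⟨e, he⟩ := Submodule.mem_span_singleton.mp Y.2
  rw [← hc, ← he]
  exact ((Commute.refl (H u)).smul_left c).smul_right e

lemma expA_add {d : ℕ} {u : Fin d → ℝ} (X Y : lieA u) : expA (X + Y) = expA X * expA Y := by
  apply Subtype.ext
  apply Units.ext
  exact Matrix.exp_add_of_commute (X : Mat d) (Y : Mat d) (lieA_commute X Y)

lemma expA_zero {d : ℕ} {u : Fin d → ℝ} : expA (0 : lieA u) = 1 := by
  have h := expA_add (0 : lieA u) 0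
  rw [add_zero] at h
  exact left_eq_mul.mp h

/-- `A = exp 𝔞`. -/
def A {d : ℕ} (u : Fin d → ℝ) : Subgroup (G d) where
  carrier := Set.range (expA (u := u))
  mul_mem' := by
    rintro _ _ ⟨X, rfl⟩ ⟨Y, rfl⟩
    exact ⟨X + Y, expA_add X Y⟩
  one_mem' := ⟨0, expA_zero⟩
  inv_mem' := by
    rintro _ ⟨X, rfl⟩
    refine ⟨-X, ?_⟩
    rw [eq_inv_iff_mul_eq_one, ← expA_add, neg_add_cancel, expA_zero]

/-- `M`, the centraliser of `A` in `K`. -/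
def M {d : ℕ} (u : Fin d → ℝ) : Subgroup (G d) := Subgroup.centralizer (A u : Set (G d)) ⊓ K d

/-- `𝔫`, the root space in `𝔤` of the root `α` with `α(H₁) = 1`. -/
def lieN {d : ℕ} (u : Fin d → ℝ) : Submodule ℝ (Mat d) where
  carrier := {Y | Y ∈ lieG d ∧ H u * Y - Y * H u = Y}
  add_mem' := by
    rintro X Y ⟨hX, eX⟩ ⟨hY, eY⟩
    refine ⟨(lieG d).add_mem hX hY, ?_⟩
    nth_rewrite 3 [← eX]
    nth_rewrite 3 [← eY]
    noncomm_ring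
  zero_mem' := ⟨(lieG d).zero_mem, by simp⟩
  smul_mem' := by
    rintro c X ⟨hX, eX⟩
    refine ⟨(lieG d).smul_mem c hX, ?_⟩
    rw [Matrix.mul_smul, Matrix.smul_mul, ← smul_sub, eX]

/-- `N = exp 𝔫`. -/
def N {d : ℕ} (u : Fin d → ℝ) : Set (G d) := {n | ∃ Y : lieG d, (Y : Mat d) ∈ lieN u ∧ n = expG Y}

/-- The commutator with `X ∈ 𝔞`, as an endomorphism of `𝔫`. -/
def adN {d : ℕ} (u : Fin d → ℝ) : lieA u →ₗ[ℝ] Module.End ℝ (lieN u) where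
  toFun X :=
    { toFun := fun Y => ⟨(X : Mat d) * Y - Y * X, by
        obtain ⟨c, hc⟩ := Submodule.mem_span_singleton.mp X.2
        have h : (X : Mat d) * Y - Y * X = c • (Y : Mat d) := by
          rw [← hc, Matrix.smul_mul, Matrix.mul_smul, ← smul_sub, Y.2.2]
        rw [h]
        exact (lieN u).smul_mem c Y.2⟩
      map_add' := fun Y Z => Subtype.ext (by
        simp only [Submodule.coe_add]; noncomm_ring)
      map_smul' := fun c Y => Subtype.ext (by
        simp [smul_sub]) }
  map_add' X Y := LinearMap.ext fun Z => Subtype.ext (by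
    simp; noncomm_ring)
  map_smul' c X := LinearMap.ext fun Z => Subtype.ext (by
    simp [smul_sub])

/-- The modular shift `ρ ∈ 𝔞*`, `2ρ(X) = tr(ad X | 𝔫)`. -/
def rho {d : ℕ} (u : Fin d → ℝ) : lieA u →ₗ[ℝ] ℝ :=
  (1 / 2 : ℝ) • (LinearMap.trace ℝ (lieN u) ∘ₗ adN u)

/-- The defining property of `ρ`: `a^(2ρ) = det(Ad a | 𝔫)` for `a = exp X`. -/
lemma rho_spec {d : ℕ} (u : Fin d → ℝ) (X : lieA u) (E : Module.End ℝ (lieN u))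
    (hE : ∀ Y : lieN u, (E Y : Mat d) = NormedSpace.exp (X : Mat d) * Y *
      NormedSpace.exp (-(X : Mat d))) :
    Real.exp (2 * rho u X) = LinearMap.det E := by
  obtain ⟨c, hc⟩ := Submodule.mem_span_singleton.mp X.2
  have h1 : adN u X = c • LinearMap.id := by
    ext1 Y
    apply Subtype.ext
    show (X : Mat d) * Y - Y * X = c • (Y : Mat d)
    rw [← hc, Matrix.smul_mul, Matrix.mul_smul, ← smul_sub, Y.2.2]
  have h2 : E = Real.exp c • LinearMap.id := by
    ext1 Y
    apply Subtype.ext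
    rw [hE]
    show _ = Real.exp c • (Y : Mat d)
    have hXY : (Y : Mat d) * ((X : Mat d) + c • 1) = (X : Mat d) * Y := by
      have h3 : H u * (Y : Mat d) = Y * H u + Y := by
        nth_rewrite 3 [← Y.2.2]
        abel
      rw [← hc, Matrix.mul_add, Matrix.smul_mul, h3, smul_add, Matrix.mul_smul, Matrix.mul_smul,
        Matrix.mul_one]
    have hs : SemiconjBy (Y : Mat d) ((X : Mat d) + c • 1) (X : Mat d) := hXY
    have h4 : NormedSpace.exp (X : Mat d) * Y
        = Y * NormedSpace.exp ((X : Mat d) + c • (1 : Mat d)) := exp_semiconj hs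
    have h5 : NormedSpace.exp (c • (1 : Mat d)) = Real.exp c • (1 : Mat d) := by
      rw [Matrix.smul_one_eq_diagonal, Matrix.smul_one_eq_diagonal, Matrix.exp_diagonal,
        Pi.exp_def, Real.exp_eq_exp_ℝ]
    rw [h4, Matrix.mul_assoc, Matrix.exp_add_of_commute _ _ ((Commute.one_right _).smul_right c), h5]
    simp only [Matrix.mul_smul, Matrix.smul_mul, Matrix.mul_one]
    rw [← Matrix.exp_add_of_commute _ _ (by simp)]
    simp
  rw [h2, LinearMap.det_smul, LinearMap.det_id, mul_one, ← Real.exp_nat_mul]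
  simp only [rho, LinearMap.smul_apply, LinearMap.comp_apply, h1, map_smul,
    LinearMap.trace_id, smul_eq_mul]
  ring_nf

/-- The order on real functionals on `𝔞` for which `tρ > 0 ↔ t > 0`. -/
def PosOnA {d : ℕ} (u : Fin d → ℝ) (μ : lieA u →ₗ[ℝ] ℝ) : Prop := ∃ t : ℝ, 0 < t ∧ μ = t • rho u

/-- Smoothness of a vector valued function on the closed submanifold `G` of the space of matrices:
locally it is the restriction of a smooth function of the matrix. -/
def SmoothOnG {d : ℕ} {V : Type*} [NormedAddCommGroup V] [NormedSpace ℝ V] (f : G d → V) : Prop :=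
  ∀ g : G d, ∃ U : Set (Mat d), IsOpen U ∧ (g : Mat d) ∈ U ∧
    ∃ F : Mat d → V, ContDiffOn ℝ ∞ F U ∧ ∀ h : G d, (h : Mat d) ∈ U → F h = f h

section Series

variable {d : ℕ} {u : Fin d → ℝ} {V : Type*} [NormedAddCommGroup V] [NormedSpace ℂ V]

/-- The space of smooth vectors of the principal series representation: smooth `f : G → V_σ` with
`f(m a n x) = a^(λ+ρ) σ(m) f(x)`, where `a = exp X`, `a^(λ+ρ) = e^((λ+ρ)(X))`. The group `G` acts
by right translation. -/
def smoothSeries (σ : Representation ℂ (M u) V) (lam : lieA u →ₗ[ℝ] ℂ) :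
    Submodule ℂ (G d → V) where
  carrier := {f | SmoothOnG f ∧ ∀ (m : M u) (X : lieA u), ∀ n ∈ N u, ∀ x : G d,
    f (m * expA X * n * x) = Complex.exp (lam X + (rho u X : ℂ)) • σ m (f x)}
  add_mem' := by
    rintro f f' ⟨sf, hf⟩ ⟨sf', hf'⟩
    refine ⟨fun g => ?_, fun m X n hn x => ?_⟩
    · obtain ⟨U, oU, gU, F, cF, eF⟩ := sf g
      obtain ⟨U', oU', gU', F', cF', eF'⟩ := sf' g
      exact ⟨U ∩ U', oU.inter oU', ⟨gU, gU'⟩, fun x => F x + F' x,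
        (cF.mono Set.inter_subset_left).add (cF'.mono Set.inter_subset_right),
        fun h hh => by simp [eF h hh.1, eF' h hh.2]⟩
    · simp [hf m X n hn x, hf' m X n hn x]
  zero_mem' := ⟨fun g => ⟨Set.univ, isOpen_univ, trivial, fun _ => 0, contDiffOn_const,
    fun _ _ => rfl⟩, by simp⟩
  smul_mem' := by
    rintro c f ⟨sf, hf⟩
    refine ⟨fun g => ?_, fun m X n hn x => ?_⟩
    · obtain ⟨U, oU, gU, F, cF, eF⟩ := sf g
      exact ⟨U, oU, gU, fun x => c • F x, cF.const_smul c, fun h hh => by simp [eF h hh]⟩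
    · simp [hf m X n hn x, smul_comm c]

/-- The space of `M`-invariant smooth vectors. -/
def smoothSeriesM (σ : Representation ℂ (M u) V) (lam : lieA u →ₗ[ℝ] ℂ) :
    Submodule ℂ (G d → V) where
  carrier := {f | f ∈ smoothSeries σ lam ∧ ∀ (m : M u) (x : G d), f (x * m) = f x}
  add_mem' := by
    rintro f f' ⟨sf, hf⟩ ⟨sf', hf'⟩
    exact ⟨add_mem sf sf', fun m x => by simp [hf m x, hf' m x]⟩
  zero_mem' := ⟨zero_mem _, by simp⟩
  smul_mem' := by
    rintro c f ⟨sf, hf⟩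
    exact ⟨Submodule.smul_mem _ c sf, fun m x => by simp [hf m x]⟩

/-- The integrand `l(f(w₀ n₀ a)) a^(-k λ_γ)` at `a = exp(t H₁)`. -/
def integrand (lamγ : lieA u →ₗ[ℝ] ℂ) (w₀ n₀ : G d) (k : ℤ) (l : Module.Dual ℂ V) (f : G d → V)
    (t : ℝ) : ℂ :=
  l (f (w₀ * n₀ * expA (t • H₁ u))) * Complex.exp (-(k : ℂ) * lamγ (t • H₁ u))

/-- The integral of `l(f(w₀ n₀ a)) a^(-k λ_γ)` over `A`, with the Haar measure given by arc
length. -/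
def I (lamγ : lieA u →ₗ[ℝ] ℂ) (w₀ n₀ : G d) (k : ℤ) (l : Module.Dual ℂ V) (f : G d → V) : ℂ :=
  ∫ t : ℝ, integrand lamγ w₀ n₀ k l f t

end Series

/-- `w` is a representative in `K` of the non-trivial element of the Weyl group
`W(G, A) = N_K(A) / Z_K(A)`. -/
def IsWeylRep {d : ℕ} (u : Fin d → ℝ) (w : G d) : Prop :=
  w ∈ K d ∧ (∀ a : G d, a ∈ A u ↔ w * a * w⁻¹ ∈ A u) ∧ w ∉ M u

/-- `|c_k| = O(|k|^(-N))` as `|k| → ∞`, for every `N`. -/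
def RapidlyDecreasing (c : ℤ → ℂ) : Prop :=
  ∀ N : ℕ, c =O[Filter.cofinite] fun k : ℤ => (|(k : ℝ)| ^ N)⁻¹

end HypFourier

end

noncomputable section

namespace HypFourier

open MeasureTheory Filter Topology

/-! Put `g(t) = l(f(w₀ n₀ exp(tH₁)))` and `z = (λ+ρ)(H₁)`, so that `Re z > 0`. If `X_γ = r H₁`, then
`λ_γ(H₁) = 2πi/r`, and the integral is the Fourier transform of `g` at `k/r`. It therefore suffices
that `g` and all its derivatives are integrable.

As `t → +∞`, move `exp(tH₁)` to the left: `𝔫` is contracted by `e^(-t)` and `w₀` inverts `A`, so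
`g(t) = e^(-zt) φ(e^(-t))` with `φ(s) = l(f(w₀ exp(sY)))`, smooth through `s = 0`. As `t → -∞`,
first write `w₀ n₀` as an element of `A N M` times an element of `w₀ N w₀⁻¹` (`exists_bruhat`, which
needs `n₀ ≠ 1`); the same commutation yields `g(t) = e^(zt) ψ(e^t)` with `ψ` smooth. This is
`hasExpTails_orbit`. Functions with two such expressions are closed under differentiation
(`HasExpTails.deriv`) and decay exponentially at both ends (`HasExpTails.integrable`).

The Bruhat step is Lorentz geometry: `N` fixes the null vector `(u,1)` and moves the ray of `(-u,1)`
onto every other future null ray. -/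

/-! ### Exponential tails and decay of the Fourier transform. -/

/-- Functions on the line of the form `e^(-zt) φ(e^(-t))` and `e^(zt) ψ(e^t)` with `φ`, `ψ`
smooth on the whole line. -/
def HasExpTails (z : ℂ) (g : ℝ → ℂ) : Prop :=
  (∃ φ : ℝ → ℂ, ContDiff ℝ ∞ φ ∧ ∀ t : ℝ, g t = Complex.exp (-z * t) * φ (Real.exp (-t))) ∧
    ∃ ψ : ℝ → ℂ, ContDiff ℝ ∞ ψ ∧ ∀ t : ℝ, g t = Complex.exp (z * t) * ψ (Real.exp t)

/-- Serves both tails: `(w, c)` is `(-z, -1)` or `(z, 1)`. The bracket is again a smooth function of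
`e^(ct)`. -/
lemma hasDerivAt_exp_mul_comp_exp {φ : ℝ → ℂ} (hφ : ContDiff ℝ ∞ φ) (w : ℂ) (c t : ℝ) :
    HasDerivAt (fun t : ℝ => Complex.exp (w * t) * φ (Real.exp (c * t)))
      (Complex.exp (w * t) * (w * φ (Real.exp (c * t)) +
        c * ((Real.exp (c * t) : ℝ) : ℂ) * deriv φ (Real.exp (c * t)))) t := by
  have h1 : HasDerivAt (fun t : ℝ => Complex.exp (w * t)) (Complex.exp (w * t) * (w * 1)) t :=
    ((Complex.ofRealCLM.hasDerivAt (x := t)).const_mul w).cexp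
  have h2 : HasDerivAt (fun t : ℝ => Real.exp (c * t)) (Real.exp (c * t) * (c * 1)) t :=
    ((hasDerivAt_id t).const_mul c).exp
  have h3 : HasDerivAt φ (deriv φ (Real.exp (c * t))) (Real.exp (c * t)) :=
    (hφ.differentiable (by simp) _).hasDerivAt
  have h4 := h1.mul (h3.scomp t h2)
  refine h4.congr_deriv ?_
  simp only [Function.comp, Complex.real_smul]
  push_cast
  ring

lemma contDiff_expTail_deriv {φ : ℝ → ℂ} (hφ : ContDiff ℝ ∞ φ) (w : ℂ) (c : ℝ) :
    ContDiff ℝ ∞ fun s : ℝ => w * φ s + c * (s : ℂ) * deriv φ s := by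
  have h1 : ContDiff ℝ ∞ (deriv φ) := (contDiff_infty_iff_deriv.mp hφ).2
  have h2 : ContDiff ℝ ∞ fun s : ℝ => (s : ℂ) := Complex.ofRealCLM.contDiff
  exact (contDiff_const.mul hφ).add ((contDiff_const.mul h2).mul h1)

/-- Each of the two expressions holds on the whole line, so one is enough. -/
lemma HasExpTails.differentiable {z : ℂ} {g : ℝ → ℂ} (hg : HasExpTails z g) :
    Differentiable ℝ g := by
  obtain ⟨-, ψ, hψ, eψ⟩ := hg
  intro t
  have h := (hasDerivAt_exp_mul_comp_exp hψ z 1 t).differentiableAt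
  simp only [one_mul] at h
  rwa [← funext eψ] at h

lemma HasExpTails.deriv {z : ℂ} {g : ℝ → ℂ} (hg : HasExpTails z g) :
    HasExpTails z (deriv g) := by
  obtain ⟨⟨φ, hφ, eφ⟩, ψ, hψ, eψ⟩ := hg
  refine ⟨⟨_, contDiff_expTail_deriv hφ (-z) (-1), fun t => ?_⟩,
    _, contDiff_expTail_deriv hψ z 1, fun t => ?_⟩
  · have h := (hasDerivAt_exp_mul_comp_exp hφ (-z) (-1) t).deriv
    simp only [neg_one_mul] at h ⊢
    rw [funext eφ, h]
  · have h := (hasDerivAt_exp_mul_comp_exp hψ z 1 t).deriv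
    simp only [one_mul] at h
    rw [funext eψ, h]

lemma isBigO_exp_mul_of_tendsto_zero {w : ℂ} {φ : ℝ → ℂ} (hφ : Continuous φ) {c : ℝ → ℝ}
    {F : Filter ℝ} (hc : Tendsto c F (𝓝 0)) :
    (fun t : ℝ => Complex.exp (w * t) * φ (c t)) =O[F] fun t => Real.exp (w.re * t) := by
  have h1 : (fun t => φ (c t)) =O[F] fun _ => (1 : ℝ) :=
    (Tendsto.comp hφ.continuousAt hc).isBigO_one ℝ
  have h2 : (fun t : ℝ => Complex.exp (w * t)) =O[F] fun t => Real.exp (w.re * t) := by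
    refine Asymptotics.isBigO_of_le _ fun t => ?_
    rw [Complex.norm_exp, Real.norm_of_nonneg (Real.exp_pos _).le]
    simp
  simpa using h2.mul h1

/-- Continuity of `φ` and `ψ` at `0` bounds them along the tails, leaving the factor `e^(-Re z
|t|)`. -/
lemma HasExpTails.integrable {z : ℂ} (hz : 0 < z.re) {g : ℝ → ℂ} (hg : HasExpTails z g) :
    Integrable g := by
  have hloc : LocallyIntegrable g := hg.differentiable.continuous.locallyIntegrable
  obtain ⟨⟨φ, hφ, eφ⟩, ψ, hψ, eψ⟩ := hg
  have hb : g =O[atBot] fun t => Real.exp (z.re * t) := by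
    rw [funext eψ]
    exact isBigO_exp_mul_of_tendsto_zero hψ.continuous Real.tendsto_exp_atBot
  have ht : g =O[atTop] fun t => Real.exp ((-z).re * t) := by
    rw [funext eφ]
    exact isBigO_exp_mul_of_tendsto_zero hφ.continuous Real.tendsto_exp_neg_atTop_nhds_zero
  refine hloc.integrable_of_isBigO_atBot_atTop hb
    ⟨Set.Iic 0, Iic_mem_atBot 0, integrableOn_exp_mul_Iic hz 0⟩ ht
    ⟨Set.Ioi 0, Ioi_mem_atTop 0, integrableOn_exp_mul_Ioi (by simpa using hz) 0⟩

/-- Each factor `2πx` is traded for a derivative of `g`, which has tails of the same kind with the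
same `z`. -/
lemma HasExpTails.fourier_bound {z : ℂ} (hz : 0 < z.re) (n : ℕ) {g : ℝ → ℂ}
    (hg : HasExpTails z g) :
    ∃ C : ℝ, ∀ x : ℝ, |2 * Real.pi * x| ^ n * ‖FourierTransform.fourier g x‖ ≤ C := by
  induction n generalizing g with
  | zero =>
    refine ⟨∫ t, ‖g t‖, fun x => ?_⟩
    rw [pow_zero, one_mul, Real.fourier_real_eq]
    exact (norm_integral_le_integral_norm _).trans_eq (by simp)
  | succ n ih =>
    obtain ⟨C, hC⟩ := ih hg.deriv
    refine ⟨C, fun x => (le_of_eq ?_).trans (hC x)⟩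
    rw [Real.fourier_deriv (hg.integrable hz) hg.differentiable (hg.deriv.integrable hz),
      norm_smul, pow_succ]
    simp [abs_mul]
    ring

lemma HasExpTails.rapidlyDecreasing {z : ℂ} (hz : 0 < z.re) {g : ℝ → ℂ} (hg : HasExpTails z g)
    {c : ℝ} (hc : c ≠ 0) :
    RapidlyDecreasing fun k : ℤ => ∫ t : ℝ, g t *
      Complex.exp (-(k : ℂ) * (t * (2 * Real.pi * Complex.I * c))) := by
  intro n
  obtain ⟨C, hC⟩ := hg.fourier_bound hz n
  have hp : 0 < |2 * Real.pi * c| := abs_pos.mpr (by positivity)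
  refine Asymptotics.IsBigO.of_bound (C / |2 * Real.pi * c| ^ n) ?_
  filter_upwards [(Set.finite_singleton (0 : ℤ)).compl_mem_cofinite] with k hk
  have hk' : 0 < |(k : ℝ)| := abs_pos.mpr (by exact_mod_cast hk)
  have e : (∫ t : ℝ, g t * Complex.exp (-(k : ℂ) * (t * (2 * Real.pi * Complex.I * c))))
      = FourierTransform.fourier g (k * c) := by
    rw [Real.fourier_real_eq_integral_exp_smul]
    congr 1
    ext t
    rw [smul_eq_mul, mul_comm]
    congr 2
    push_cast
    ring
  rw [e, norm_inv, norm_pow, Real.norm_eq_abs, abs_abs, ← div_eq_mul_inv, div_div,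
    le_div_iff₀ (by positivity)]
  refine (le_of_eq ?_).trans (hC (k * c))
  rw [show 2 * Real.pi * ((k : ℝ) * c) = (2 * Real.pi * c) * k by ring, abs_mul _ (k : ℝ), mul_pow]
  ring

lemma HasExpTails.integrable_twist {z : ℂ} (hz : 0 < z.re) {g : ℝ → ℂ} (hg : HasExpTails z g)
    (k : ℤ) (c : ℝ) :
    Integrable fun t : ℝ => g t * Complex.exp (-(k : ℂ) * (t * (2 * Real.pi * Complex.I * c))) := by
  refine (hg.integrable hz).mul_bdd (c := 1) (Continuous.aestronglyMeasurable (by fun_prop))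
    (Filter.Eventually.of_forall fun t => ?_)
  rw [Complex.norm_exp]
  simp

-- Matrix exponentials, the Lorentz form and the matrices of `𝔫`.

attribute [local instance] Matrix.normedAddCommGroup Matrix.normedSpace

lemma exp_mulVec_of_eigen {n : Type*} [Fintype n] [DecidableEq n] {B : Matrix n n ℝ} {v : n → ℝ}
    {c : ℝ} (h : B *ᵥ v = c • v) : NormedSpace.exp B *ᵥ v = Real.exp c • v := by
  -- The matrix with every column equal to `v` turns the eigenvector equation into an intertwining
  -- relation, which exponentiates.
  have hs : SemiconjBy (Matrix.of fun i _ : n => v i) (Matrix.diagonal fun _ => c) B := by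
    ext i j
    have := congrFun h i
    simp only [Matrix.mulVec, dotProduct, Pi.smul_apply, smul_eq_mul] at this
    rw [Matrix.mul_diagonal, Matrix.mul_apply]
    simp only [Matrix.of_apply, this, mul_comm]
  have he := exp_semiconj hs
  rw [Matrix.exp_diagonal] at he
  ext i
  have := congrFun (congrFun he i) i
  rw [Matrix.mul_diagonal, Matrix.mul_apply, Pi.exp_def] at this
  simp only [Matrix.of_apply, ← Real.exp_eq_exp_ℝ] at this
  simp only [Matrix.mulVec, dotProduct, Pi.smul_apply, smul_eq_mul, this]
  exact mul_comm _ _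

lemma exp_eq_of_cube_eq_zero {n : Type*} [Fintype n] [DecidableEq n] {Y : Matrix n n ℝ}
    (h : Y ^ 3 = 0) : NormedSpace.exp Y = 1 + Y + (1 / 2 : ℝ) • Y ^ 2 := by
  have hz : ∀ k ∉ Finset.range 3, ((Nat.factorial k : ℝ)⁻¹) • Y ^ k = 0 := fun k hk => by
    rw [pow_eq_zero_of_le (by simpa using hk) h, smul_zero]
  rw [NormedSpace.exp_eq_tsum ℝ]
  show (∑' k : ℕ, ((Nat.factorial k : ℝ)⁻¹) • Y ^ k) = _
  rw [tsum_eq_sum hz]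
  simp [Finset.sum_range_succ, Nat.factorial]

/-- The Lorentz form. -/
def form {d : ℕ} (v w : Fin d ⊕ Unit → ℝ) : ℝ := v ⬝ᵥ (J d *ᵥ w)

lemma form_mulVec {d : ℕ} (g : G d) (v w : Fin d ⊕ Unit → ℝ) :
    form ((g : Mat d) *ᵥ v) ((g : Mat d) *ᵥ w) = form v w := by
  rw [form, form, Matrix.mulVec_mulVec, Matrix.dotProduct_mulVec, Matrix.vecMul_mulVec,
    ← Matrix.dotProduct_mulVec, ← Matrix.mul_assoc, g.2.1]

lemma form_apply {d : ℕ} (v w : Fin d ⊕ Unit → ℝ) :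
    form v w = ∑ i, v (Sum.inl i) * w (Sum.inl i) - v (Sum.inr ()) * w (Sum.inr ()) := by
  simp [form, J, LieAlgebra.Orthogonal.indefiniteDiagonal, Matrix.mulVec_diagonal, dotProduct,
    sub_eq_add_neg]

/-- The vector with space part `y` and time coordinate `s`. -/
def vec {d : ℕ} (y : Fin d → ℝ) (s : ℝ) : Fin d ⊕ Unit → ℝ := Sum.elim y fun _ => s

lemma form_vec {d : ℕ} (y y' : Fin d → ℝ) (s s' : ℝ) :
    form (vec y s) (vec y' s') = y ⬝ᵥ y' - s * s' := by
  simp [form_apply, vec, dotProduct]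

lemma vec_eta {d : ℕ} (v : Fin d ⊕ Unit → ℝ) :
    v = vec (fun i => v (Sum.inl i)) (v (Sum.inr ())) := by
  ext (i | i) <;> rfl

lemma vec_add {d : ℕ} (y y' : Fin d → ℝ) (s s' : ℝ) :
    vec y s + vec y' s' = vec (y + y') (s + s') := by
  ext (i | i) <;> rfl

lemma smul_vec {d : ℕ} (c : ℝ) (y : Fin d → ℝ) (s : ℝ) :
    c • vec y s = vec (c • y) (c * s) := by
  ext (i | i) <;> rfl

lemma single_eq_vec {d : ℕ} : (Pi.single (Sum.inr ()) 1 : Fin d ⊕ Unit → ℝ) = vec 0 1 := by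
  ext (i | i) <;> simp [vec]

lemma H_mulVec {d : ℕ} (u y : Fin d → ℝ) (s : ℝ) :
    H u *ᵥ vec y s = vec (s • u) (u ⬝ᵥ y) := by
  ext (i | i) <;> simp [H, vec, Matrix.mulVec, dotProduct, mul_comm]

/-- The element of `𝔫` determined by the vector `y` orthogonal to `u`. -/
def nilMat {d : ℕ} (u y : Fin d → ℝ) : Mat d :=
  Matrix.fromBlocks (Matrix.vecMulVec u y - Matrix.vecMulVec y u) (Matrix.replicateCol Unit y)
    (Matrix.replicateRow Unit y) 0

lemma nilMat_mulVec {d : ℕ} (u y y' : Fin d → ℝ) (s : ℝ) :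
    nilMat u y *ᵥ vec y' s = vec ((y ⬝ᵥ y') • u - (u ⬝ᵥ y') • y + s • y) (y ⬝ᵥ y') := by
  ext (i | i)
  · simp only [nilMat, vec, Matrix.mulVec, dotProduct, Fintype.sum_sum_type,
      Matrix.fromBlocks_apply₁₁, Matrix.fromBlocks_apply₁₂, Matrix.sub_apply,
      Matrix.vecMulVec_apply, Matrix.replicateCol_apply, Sum.elim_inl, Sum.elim_inr,
      Finset.univ_unique, Finset.sum_singleton, Pi.add_apply, Pi.sub_apply, Pi.smul_apply,
      smul_eq_mul, Finset.sum_mul, ← Finset.sum_sub_distrib]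
    congr 1
    · exact Finset.sum_congr rfl fun j _ => by ring
    · ring
  · simp [nilMat, vec, Matrix.mulVec, dotProduct]

lemma mat_ext {d : ℕ} {B C : Mat d} (h : ∀ y s, B *ᵥ vec y s = C *ᵥ vec y s) : B = C := by
  refine Matrix.ext_of_mulVec_single fun j => ?_
  rw [vec_eta (Pi.single j 1)]
  exact h _ _

lemma nilMat_mem {d : ℕ} {u y : Fin d → ℝ} (hu : u ⬝ᵥ u = 1) (hy : u ⬝ᵥ y = 0) :
    nilMat u y ∈ lieN u := by
  refine ⟨?_, mat_ext fun y' s => ?_⟩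
  · rw [mem_lieG]
    ext i j
    rcases i with i | i <;> rcases j with j | j <;>
    simp [nilMat, J, LieAlgebra.Orthogonal.indefiniteDiagonal, Matrix.vecMulVec_apply, mul_comm]
  · rw [Matrix.sub_mulVec, ← Matrix.mulVec_mulVec, ← Matrix.mulVec_mulVec, nilMat_mulVec, H_mulVec,
      H_mulVec, nilMat_mulVec]
    have hy' : y ⬝ᵥ u = 0 := by rw [dotProduct_comm]; exact hy
    simp only [dotProduct_add, dotProduct_sub, dotProduct_smul, hu, hy, hy', smul_eq_mul]
    ext (i | i) <;> simp [vec]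
    ring

lemma exists_nilMat {d : ℕ} {u : Fin d → ℝ} (hu : u ⬝ᵥ u = 1) {Y : Mat d} (hY : Y ∈ lieN u) :
    ∃ y, u ⬝ᵥ y = 0 ∧ Y = nilMat u y := by
  obtain ⟨h1, h2⟩ := hY
  rw [mem_lieG] at h1
  have a1 : ∀ i j, Y (Sum.inl j) (Sum.inl i) = -Y (Sum.inl i) (Sum.inl j) := fun i j => by
    simpa [J, LieAlgebra.Orthogonal.indefiniteDiagonal] using
      congrFun (congrFun h1 (Sum.inl i)) (Sum.inl j)
  have a2 : ∀ i, Y (Sum.inr ()) (Sum.inl i) = Y (Sum.inl i) (Sum.inr ()) := fun i => by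
    simpa [J, LieAlgebra.Orthogonal.indefiniteDiagonal] using
      congrFun (congrFun h1 (Sum.inl i)) (Sum.inr ())
  have b0 := congrFun (congrFun h2 (Sum.inr ())) (Sum.inr ())
  have b1 := fun i j => congrFun (congrFun h2 (Sum.inl i)) (Sum.inl j)
  have b2 := fun i => congrFun (congrFun h2 (Sum.inl i)) (Sum.inr ())
  simp [H, Matrix.mul_apply] at b0 b1 b2
  have a0 : Y (Sum.inr ()) (Sum.inr ()) = 0 := by
    rw [← b0, sub_eq_zero]
    exact Finset.sum_congr rfl fun i _ => by rw [a2, mul_comm]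
  set y : Fin d → ℝ := fun i => Y (Sum.inl i) (Sum.inr ()) with hy
  have hYy : Y = nilMat u y := by
    ext (i | i) (j | j)
    · simp [nilMat, Matrix.vecMulVec_apply, hy, ← b1 i j, a2]
    · simp [nilMat, hy]
    · simp [nilMat, hy, a2]
    · simpa [nilMat] using a0
  refine ⟨y, ?_, hYy⟩
  -- Applying the bracket relation to the base point and pairing with `(u, 0)` leaves exactly `u ⬝ᵥ
  -- y = 0`.
  have h3 : H u *ᵥ (Y *ᵥ vec 0 1) = Y *ᵥ vec 0 1 + Y *ᵥ (H u *ᵥ vec 0 1) := by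
    rw [Matrix.mulVec_mulVec, Matrix.mulVec_mulVec, ← Matrix.add_mulVec, ← sub_eq_iff_eq_add.mp h2]
  have h4 := congrArg (form (vec u 0)) h3
  simp only [hYy, nilMat_mulVec, H_mulVec, vec_add, form_vec, dotProduct_comm y u, dotProduct_add,
    dotProduct_sub, dotProduct_smul, hu, dotProduct_zero, smul_eq_mul] at h4
  linarith

lemma nilMat_cube {d : ℕ} {u y : Fin d → ℝ} (hu : u ⬝ᵥ u = 1) (hy : u ⬝ᵥ y = 0) :
    nilMat u y ^ 3 = 0 := by
  have hy' : y ⬝ᵥ u = 0 := by rw [dotProduct_comm]; exact hy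
  refine mat_ext fun y' s => ?_
  rw [pow_succ, pow_two, ← Matrix.mulVec_mulVec, ← Matrix.mulVec_mulVec]
  simp only [nilMat_mulVec, dotProduct_add, dotProduct_sub, dotProduct_smul, hu, hy, hy',
    smul_eq_mul]
  ext (i | i) <;> simp [vec]

/-- Needed at `c = 1`, the null vector fixed by `N`, and at `c = -1`, the one that `N` moves. -/
lemma exp_nilMat_mulVec {d : ℕ} {u y : Fin d → ℝ} (hu : u ⬝ᵥ u = 1) (hy : u ⬝ᵥ y = 0)
    (c : ℝ) : NormedSpace.exp (nilMat u y) *ᵥ vec (c • u) 1 =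
      vec (c • u + (1 - c) • y + ((1 - c) / 2 * (y ⬝ᵥ y)) • u) (1 + (1 - c) / 2 * (y ⬝ᵥ y)) := by
  have hy' : y ⬝ᵥ u = 0 := by rw [dotProduct_comm]; exact hy
  rw [exp_eq_of_cube_eq_zero (nilMat_cube hu hy), Matrix.add_mulVec, Matrix.add_mulVec,
    Matrix.smul_mulVec, pow_two, ← Matrix.mulVec_mulVec]
  simp only [nilMat_mulVec, dotProduct_add, dotProduct_sub, dotProduct_smul, hu, hy, hy',
    smul_eq_mul, Matrix.one_mulVec, vec_add, smul_vec]
  ext (i | i) <;> simp [vec] <;> ring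

/-! ### The action of `A`, `M`, `N` and the Weyl element on Lorentz space. -/

/-- The linear action of `G` on Lorentz space. -/
def act {d : ℕ} (g : G d) (v : Fin d ⊕ Unit → ℝ) : Fin d ⊕ Unit → ℝ := (g : Mat d) *ᵥ v

lemma act_mul {d : ℕ} (g h : G d) (v : Fin d ⊕ Unit → ℝ) : act (g * h) v = act g (act h v) :=
  (Matrix.mulVec_mulVec _ _ _).symm

lemma act_one {d : ℕ} (v : Fin d ⊕ Unit → ℝ) : act 1 v = v := Matrix.one_mulVec v

lemma act_smul {d : ℕ} (g : G d) (c : ℝ) (v : Fin d ⊕ Unit → ℝ) :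
    act g (c • v) = c • act g v := Matrix.mulVec_smul _ _ _

lemma act_add {d : ℕ} (g : G d) (v w : Fin d ⊕ Unit → ℝ) :
    act g (v + w) = act g v + act g w := Matrix.mulVec_add _ _ _

lemma act_sub {d : ℕ} (g : G d) (v w : Fin d ⊕ Unit → ℝ) :
    act g (v - w) = act g v - act g w := Matrix.mulVec_sub _ _ _

lemma act_inv_eq {d : ℕ} {g : G d} {v w : Fin d ⊕ Unit → ℝ} (h : act g v = w) :
    act g⁻¹ w = v := by
  rw [← h, ← act_mul, inv_mul_cancel, act_one]

lemma form_act {d : ℕ} (g : G d) (v w : Fin d ⊕ Unit → ℝ) :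
    form (act g v) (act g w) = form v w := form_mulVec g v w

lemma form_smul_left {d : ℕ} (c : ℝ) (v w : Fin d ⊕ Unit → ℝ) :
    form (c • v) w = c * form v w := by simp [form]

lemma form_smul_right {d : ℕ} (c : ℝ) (v w : Fin d ⊕ Unit → ℝ) :
    form v (c • w) = c * form v w := by simp [form, Matrix.mulVec_smul]

lemma H_mulVec_eq {d : ℕ} (u : Fin d → ℝ) (v : Fin d ⊕ Unit → ℝ) :
    H u *ᵥ v = form v (vec u 0) • vec 0 1 - form v (vec 0 1) • vec u 0 := by
  rw [vec_eta v, H_mulVec, form_vec, form_vec, dotProduct_comm _ u]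
  ext (i | i) <;> simp [vec]

lemma mem_K_iff {d : ℕ} {g : G d} : g ∈ K d ↔ act g (vec 0 1) = vec 0 1 := by
  rw [← single_eq_vec]; rfl

section

variable {d : ℕ} {u : Fin d → ℝ}

/-- By `H_mulVec_eq`, `H u` is built from the form and the vectors `(0,1)`, `(u,0)` alone, so `g`
conjugates it to `ε • H u`. The sign `ε` is `1` for elements of `M` and `-1` for the Weyl element.
-/
lemma mul_expA_of_act {g : G d} {ε : ℝ} (hε : ε * ε = 1) (h0 : act g (vec 0 1) = vec 0 1)
    (h1 : act g (vec u 0) = ε • vec u 0) (X : lieA u) : g * expA X = expA (ε • X) * g := by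
  have hH : (g : Mat d) * H u = ε • (H u * (g : Mat d)) := by
    refine mat_ext fun y s => ?_
    generalize vec y s = v
    have e1 : form (act g v) (vec u 0) = ε * form v (vec u 0) := by
      rw [← form_act g v, h1, form_smul_right, ← mul_assoc, hε, one_mul]
    have e2 : form (act g v) (vec 0 1) = form v (vec 0 1) := by
      rw [← form_act g v (vec 0 1), h0]
    have e3 : H u *ᵥ act g v = ε • act g (H u *ᵥ v) := by
      rw [H_mulVec_eq, H_mulVec_eq, act_sub, act_smul, act_smul, h0, h1, e1, e2, smul_sub,
        smul_smul, smul_comm ε (form v (vec 0 1)), smul_smul ε ε, hε, one_smul]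
    rw [Matrix.smul_mulVec, ← Matrix.mulVec_mulVec, ← Matrix.mulVec_mulVec]
    change act g (H u *ᵥ v) = ε • H u *ᵥ act g v
    rw [e3, smul_smul, hε, one_smul]
  have hX : SemiconjBy (g : Mat d) (X : Mat d) (ε • (X : Mat d)) := by
    obtain ⟨c, hc⟩ := Submodule.mem_span_singleton.mp X.2
    rw [← hc, SemiconjBy, Matrix.mul_smul, hH, Matrix.smul_mul, Matrix.smul_mul, smul_comm]
  exact Subtype.ext (Units.ext (exp_semiconj hX).symm)

lemma mem_M_of_act {g : G d} (h0 : act g (vec 0 1) = vec 0 1)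
    (h1 : act g (vec u 0) = vec u 0) : g ∈ M u := by
  refine ⟨?_, mem_K_iff.mpr h0⟩
  rintro _ ⟨X, rfl⟩
  have h := mul_expA_of_act (ε := 1) (one_mul 1) h0 (by rwa [one_smul]) X
  rw [one_smul] at h
  exact h.symm

lemma act_expA (hu : u ⬝ᵥ u = 1) {c : ℝ} (hc : c * c = 1) (t : ℝ) :
    act (expA (t • H₁ u)) (vec (c • u) 1) = Real.exp (c * t) • vec (c • u) 1 := by
  refine exp_mulVec_of_eigen (B := t • H u) ?_
  rw [Matrix.smul_mulVec, H_mulVec, dotProduct_smul, hu, smul_vec, smul_vec, one_smul, smul_smul,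
    smul_eq_mul]
  congr 1
  · rw [mul_right_comm, hc, one_mul]
  · ring

lemma expA_act_base (hu : u ⬝ᵥ u = 1) (t : ℝ) :
    act (expA (t • H₁ u)) (vec 0 1) = vec (Real.sinh t • u) (Real.cosh t) := by
  have h0 : (vec 0 1 : Fin d ⊕ Unit → ℝ)
      = (1 / 2 : ℝ) • (vec ((1 : ℝ) • u) 1 + vec ((-1 : ℝ) • u) 1) := by
    ext (i | i) <;> simp [vec]; norm_num
  rw [h0, act_smul, act_add, act_expA hu (by norm_num), act_expA hu (by norm_num), Real.sinh_eq,
    Real.cosh_eq]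
  ext (i | i) <;> simp [vec] <;> ring

lemma exists_expA_eq (X : lieA u) : ∃ t : ℝ, X = t • H₁ u := by
  obtain ⟨t, ht⟩ := Submodule.mem_span_singleton.mp X.2
  exact ⟨t, Subtype.ext ht.symm⟩

lemma IsWeylRep.act_base {w : G d} (hw : IsWeylRep u w) : act w (vec 0 1) = vec 0 1 :=
  mem_K_iff.mp hw.1

/-- Write `w exp(H₁) w⁻¹ = exp(sH₁)` and apply both sides to the base point, which `w` fixes. Time
coordinates give `cosh s = cosh 1`, so `s = ±1`, and `s = 1` would put `w` in `M`. -/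
lemma IsWeylRep.act_dir (hu : u ⬝ᵥ u = 1) {w : G d} (hw : IsWeylRep u w) :
    act w (vec u 0) = (-1 : ℝ) • vec u 0 := by
  have h0 := hw.act_base
  obtain ⟨X, hX⟩ := (hw.2.1 (expA ((1 : ℝ) • H₁ u))).mp ⟨_, rfl⟩
  obtain ⟨s, rfl⟩ := exists_expA_eq X
  have h1 : act (expA (s • H₁ u)) (vec 0 1) = act w (act (expA ((1 : ℝ) • H₁ u)) (vec 0 1)) := by
    rw [hX, act_mul, act_mul, act_inv_eq h0]
  rw [expA_act_base hu, expA_act_base hu] at h1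
  have hS : Real.sinh 1 ≠ 0 := (Real.sinh_pos_iff.mpr one_pos).ne'
  have h2 : vec (Real.sinh 1 • u) (Real.cosh 1)
      = Real.sinh 1 • vec u 0 + Real.cosh 1 • (vec 0 1 : Fin d ⊕ Unit → ℝ) := by
    ext (i | i) <;> simp [vec]
  rw [h2, act_add, act_smul, act_smul, h0] at h1
  have h3 : form (act w (vec u 0)) (vec 0 1) = 0 := by
    rw [← h0, form_act, form_vec]; simp
  have h4 : Real.sinh 1 • act w (vec u 0) = vec (Real.sinh s • u) (Real.cosh s - Real.cosh 1) := by
    rw [eq_sub_of_add_eq h1.symm]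
    ext (i | i) <;> simp [vec]
  have h5 := form_smul_left (Real.sinh 1) (act w (vec u 0)) (vec 0 1)
  rw [h4, h3, form_vec] at h5
  simp only [dotProduct_zero, mul_one, mul_zero, zero_sub, neg_eq_zero, sub_eq_zero] at h5
  have h6 : |s| = 1 := by
    rw [← abs_one]
    exact le_antisymm (Real.cosh_le_cosh.mp h5.le) (Real.cosh_le_cosh.mp h5.ge)
  rw [h5, sub_self] at h4
  rcases eq_or_eq_neg_of_abs_eq h6 with rfl | rfl
  · refine absurd (mem_M_of_act h0 ?_) hw.2.2
    refine smul_right_injective _ hS ?_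
    simp only [h4, smul_vec, mul_zero]
  · refine smul_right_injective _ hS ?_
    simp only [h4, smul_vec, mul_zero, Real.sinh_neg, smul_smul, mul_neg, mul_one]

lemma IsWeylRep.mul_expA (hu : u ⬝ᵥ u = 1) {w : G d} (hw : IsWeylRep u w) (t : ℝ) :
    w * expA (t • H₁ u) = expA (-t • H₁ u) * w := by
  rw [mul_expA_of_act (ε := -1) (by norm_num) hw.act_base (hw.act_dir hu), smul_smul,
    neg_one_mul]

lemma IsWeylRep.act_null (hu : u ⬝ᵥ u = 1) {w : G d} (hw : IsWeylRep u w) (c : ℝ) :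
    act w (vec (c • u) 1) = vec (-c • u) 1 := by
  have h : ∀ c : ℝ, vec (c • u) 1 = c • vec u 0 + vec 0 1 := fun c => by
    ext (i | i) <;> simp [vec]
  rw [h, h, act_add, act_smul, hw.act_base, hw.act_dir hu, smul_smul, mul_neg_one]

/-- The exponential map from `𝔫` to `G`. -/
def expN (Y : lieN u) : G d := expG ⟨Y, Y.2.1⟩

lemma expN_mem (Y : lieN u) : expN Y ∈ N u := ⟨⟨Y, Y.2.1⟩, Y.2, rfl⟩

lemma expN_neg (Y : lieN u) : expN (-Y) = (expN Y)⁻¹ := Subtype.ext (Units.ext rfl)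

lemma expN_zero : expN (0 : lieN u) = 1 := Subtype.ext (Units.ext NormedSpace.exp_zero)

/-- Since `[H₁, Y] = Y`, conjugation by `exp(-tH₁)` scales `Y` by `e^(-t)`. This is where the
variable `e^(∓t)` of the tails comes from. -/
lemma expN_mul_expA (Y : lieN u) (t : ℝ) :
    expN Y * expA (t • H₁ u) = expA (t • H₁ u) * expN (Real.exp (-t) • Y) := by
  have hs : SemiconjBy (Y : Mat d) (t • H u + t • 1) (t • H u) := by
    have h3 : H u * (Y : Mat d) = Y * H u + Y := by
      nth_rewrite 3 [← Y.2.2]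
      abel
    rw [SemiconjBy, Matrix.mul_add, Matrix.smul_mul, h3, smul_add, Matrix.mul_smul,
      Matrix.mul_smul, Matrix.mul_one]
  have h4 := exp_semiconj hs
  have h5 : NormedSpace.exp (t • (1 : Mat d)) = Real.exp t • (1 : Mat d) := by
    rw [Matrix.smul_one_eq_diagonal, Matrix.smul_one_eq_diagonal, Matrix.exp_diagonal,
      Pi.exp_def, Real.exp_eq_exp_ℝ]
  rw [Matrix.exp_add_of_commute _ _ ((Commute.one_right _).smul_right t), h5, Matrix.mul_smul,
    Matrix.mul_one, Matrix.mul_smul] at h4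
  have h6 : SemiconjBy (NormedSpace.exp (t • H u)) (Real.exp (-t) • (Y : Mat d)) (Y : Mat d) := by
    rw [SemiconjBy, Matrix.mul_smul, h4, smul_smul, ← Real.exp_add, neg_add_cancel, Real.exp_zero,
      one_smul]
  exact Subtype.ext (Units.ext (exp_semiconj h6))

lemma act_expN_null (hu : u ⬝ᵥ u = 1) (Y : lieN u) :
    act (expN Y) (vec ((1 : ℝ) • u) 1) = vec ((1 : ℝ) • u) 1 := by
  obtain ⟨y, hy, e⟩ := exists_nilMat hu Y.2
  change NormedSpace.exp (Y : Mat d) *ᵥ _ = _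
  rw [e, exp_nilMat_mulVec hu hy]
  simp

/-- The value is `-2 (y ⬝ᵥ y)`: a non-trivial element of `N` moves `(-u, 1)` off its own ray. -/
lemma form_act_expN_neg (hu : u ⬝ᵥ u = 1) {Y : lieN u} (hY : Y ≠ 0) :
    form (act (expN Y) (vec ((-1 : ℝ) • u) 1)) (vec ((-1 : ℝ) • u) 1) < 0 := by
  obtain ⟨y, hy, e⟩ := exists_nilMat hu Y.2
  have hy0 : 0 < y ⬝ᵥ y := by
    refine lt_of_le_of_ne (Finset.sum_nonneg fun i _ => mul_self_nonneg _) fun h => hY ?_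
    have : y = 0 := dotProduct_self_eq_zero.mp h.symm
    refine Subtype.ext (e.trans ?_)
    rw [this]
    ext (i | i) (j | j) <;> simp [nilMat]
  have hy' : y ⬝ᵥ u = 0 := by rw [dotProduct_comm]; exact hy
  change form (NormedSpace.exp (Y : Mat d) *ᵥ _) _ < 0
  rw [e, exp_nilMat_mulVec hu hy, form_vec]
  simp only [add_dotProduct, smul_dotProduct, dotProduct_smul, hu, hy', smul_eq_mul]
  linarith

/-! ### Bruhat decomposition via null vectors. -/

/-- A null vector off the ray of `(u, 1)` is in the `N`-orbit of the ray of `(-u, 1)`. -/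
lemma exists_expN_act (hu : u ⬝ᵥ u = 1) {v : Fin d ⊕ Unit → ℝ} (h0 : form v v = 0)
    (h1 : form v (vec ((1 : ℝ) • u) 1) < 0) :
    ∃ Y : lieN u, v = (-form v (vec ((1 : ℝ) • u) 1) / 2) •
      act (expN Y) (vec ((-1 : ℝ) • u) 1) := by
  obtain ⟨v', s, rfl⟩ : ∃ v' s, v = vec v' s := ⟨_, _, vec_eta v⟩
  rw [form_vec] at h0 h1 ⊢
  rw [one_smul, mul_one, dotProduct_comm] at h1 ⊢
  set q := u ⬝ᵥ v' with hq
  have hc : 0 < s - q := by linarith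
  -- Forced by `exp_nilMat_mulVec` at `c = -1`: after scaling by `(s - q) / 2`, the space part
  -- orthogonal to `u` is `(s - q) • y`.
  set y : Fin d → ℝ := (s - q)⁻¹ • (v' - q • u) with hy
  have huy : u ⬝ᵥ y = 0 := by
    rw [hy, dotProduct_smul, dotProduct_sub, dotProduct_smul, hu, ← hq]; simp
  have hyy : y ⬝ᵥ y = (s + q) / (s - q) := by
    rw [hy, dotProduct_smul, smul_dotProduct, dotProduct_sub, sub_dotProduct, sub_dotProduct,
      smul_dotProduct, smul_dotProduct, dotProduct_smul, dotProduct_smul, hu,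
      dotProduct_comm v' u, ← hq, sub_eq_zero.mp h0]
    simp only [smul_eq_mul]
    field_simp
    ring
  refine ⟨⟨nilMat u y, nilMat_mem hu huy⟩, ?_⟩
  change _ = _ • (NormedSpace.exp (nilMat u y) *ᵥ _)
  rw [exp_nilMat_mulVec hu huy, smul_vec, hyy]
  ext (i | i)
  · simp [vec, hy]
    field_simp
    ring
  · simp [vec]
    field_simp
    ring

/-- The stabiliser of the ray of `(u, 1)` is contained in `A N M`. -/
lemma exists_decomp_of_act_null (hu : u ⬝ᵥ u = 1) {g : G d} {c : ℝ} (hc : 0 < c)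
    (hg : act g (vec ((1 : ℝ) • u) 1) = c • vec ((1 : ℝ) • u) 1) :
    ∃ (t : ℝ) (Y : lieN u) (m : M u), g = expA (t • H₁ u) * expN Y * m := by
  set ξ := vec ((1 : ℝ) • u) 1 with hξ
  set η := vec ((-1 : ℝ) • u) 1 with hη
  set a := expA (Real.log c • H₁ u) with ha
  have haξ : act a ξ = c • ξ := by
    rw [ha, hξ, act_expA hu (by norm_num), one_mul, Real.exp_log hc]
  have hq : act (a⁻¹ * g) ξ = ξ := by
    rw [act_mul, hg]; exact act_inv_eq haξ
  have hηη : form η η = 0 := by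
    rw [hη, form_vec]; simp [hu]
  have hηξ : form η ξ = -2 := by
    rw [hη, hξ, form_vec]; simp [hu]; norm_num
  have hp : form (act (a⁻¹ * g) η) ξ = -2 := by
    rw [← hηξ, ← form_act (a⁻¹ * g) η ξ, hq]
  -- The pairing with `ξ` is still `-2`, so the scalar is `1` and `N` brings the image of `η` back
  -- to `η` itself. What remains fixes `ξ` and `η`, hence lies in `M`.
  obtain ⟨Y, hY⟩ := exists_expN_act hu (v := act (a⁻¹ * g) η)
    (by rw [form_act, hηη]) (by rw [← hξ, hp]; norm_num)
  rw [← hξ, hp, ← hη] at hY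
  norm_num at hY
  set m := (expN Y)⁻¹ * (a⁻¹ * g) with hm
  have m1 : act m ξ = ξ := by
    rw [hm, act_mul, hq]; exact act_inv_eq (act_expN_null hu Y)
  have m2 : act m η = η := by
    rw [hm, act_mul, hY, ← act_mul, inv_mul_cancel, act_one]
  have e0 : (vec 0 1 : Fin d ⊕ Unit → ℝ) = (1 / 2 : ℝ) • (ξ + η) := by
    ext (i | i) <;> simp [vec, hξ, hη]; norm_num
  have e1 : vec u 0 = (1 / 2 : ℝ) • (ξ - η) := by
    ext (i | i) <;> simp [vec, hξ, hη]; ring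
  refine ⟨Real.log c, Y, ⟨m, mem_M_of_act ?_ ?_⟩, ?_⟩
  · rw [e0, act_smul, act_add, m1, m2]
  · rw [e1, act_smul, act_sub, m1, m2]
  · simp only [hm, ← ha]; group

/-- The Bruhat decomposition of `w n`, `n ≠ 1`, with respect to the opposite unipotent group. -/
lemma exists_bruhat (hu : u ⬝ᵥ u = 1) {w : G d} (hw : IsWeylRep u w) {Y : lieN u} (hY : Y ≠ 0) :
    ∃ (t : ℝ) (Y₁ Y₂ : lieN u) (m : M u),
      w * expN Y = expA (t • H₁ u) * expN Y₁ * m * (w * expN Y₂ * w⁻¹) := by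
  set ξ := vec ((1 : ℝ) • u) 1 with hξ
  set η := vec ((-1 : ℝ) • u) 1 with hη
  have wξ : act w ξ = η := by rw [hξ, hw.act_null hu]
  have wη : act w η = ξ := by rw [hη, hw.act_null hu, neg_neg]
  set v := act (w⁻¹ * expN (-Y)) η with hv
  have wv : act w v = act (expN (-Y)) η := by
    rw [hv, ← act_mul, mul_inv_cancel_left]
  have hv0 : form v v = 0 := by
    rw [hv, form_act, hη, form_vec]; simp [hu]
  have hvξ : form v ξ < 0 := by
    rw [← form_act w, wv, wξ]
    exact form_act_expN_neg hu (neg_ne_zero.mpr hY)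
  -- With `n = expN Y` and `n₂ = expN Y₂`, chosen so that `n₂ η` is a positive multiple of `w⁻¹ n⁻¹
  -- η`, the product `w n (w n₂ w⁻¹)` preserves the ray of `ξ`. The factor `w n₂ w⁻¹` is then moved
  -- across, whence `-Y₂` below.
  obtain ⟨Y₂, h₂⟩ := exists_expN_act hu hv0 hvξ
  rw [← hξ, ← hη] at h₂
  set c := -form v ξ / 2 with hc
  have hc0 : 0 < c := by rw [hc]; linarith
  have hnη : act (expN Y₂) η = c⁻¹ • v := by
    rw [h₂, smul_smul, inv_mul_cancel₀ hc0.ne', one_smul]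
  obtain ⟨t, Y₁, m, h⟩ := exists_decomp_of_act_null hu (inv_pos.mpr hc0)
    (g := w * expN Y * (w * expN Y₂ * w⁻¹)) (by
      rw [← hξ, act_mul, act_mul _ w⁻¹, act_inv_eq wη, act_mul w (expN Y₂), hnη, act_smul, wv, act_smul,
        act_mul w, ← act_mul (expN Y), expN_neg, mul_inv_cancel, act_one, wη])
  refine ⟨t, Y₁, -Y₂, m, ?_⟩
  rw [← h, expN_neg]
  group

end

/-! ### Tails of principal series functions along the orbit of `A`. -/

lemma SmoothOnG.contDiff_comp {d : ℕ} {V : Type*} [NormedAddCommGroup V] [NormedSpace ℝ V]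
    {f : G d → V} (hf : SmoothOnG f) {c : ℝ → G d} (hc : ContDiff ℝ ∞ fun s => (c s : Mat d)) :
    ContDiff ℝ ∞ fun s => f (c s) := by
  refine contDiff_iff_contDiffAt.mpr fun s => ?_
  obtain ⟨U, oU, hU, F, cF, eF⟩ := hf (c s)
  have h1 : ContDiffAt ℝ ∞ F (c s : Mat d) := cF.contDiffAt (oU.mem_nhds hU)
  refine (h1.comp s hc.contDiffAt).congr_of_eventuallyEq ?_
  filter_upwards [hc.continuous.continuousAt.preimage_mem_nhds (oU.mem_nhds hU)] with r hr
  exact (eF (c r) hr).symm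

section

variable {d : ℕ} {u : Fin d → ℝ}

/-- As `Y ^ 3 = 0`, the curve is a quadratic polynomial in `s`. -/
lemma contDiff_mul_expN_mul (hu : u ⬝ᵥ u = 1) (a b : G d) (Y : lieN u) :
    ContDiff ℝ ∞ fun s : ℝ => ((a * expN (s • Y) * b : G d) : Mat d) := by
  obtain ⟨y, hy, e⟩ := exists_nilMat hu Y.2
  have h3 : (Y : Mat d) ^ 3 = 0 := by rw [e, nilMat_cube hu hy]
  have h : ∀ s : ℝ, ((a * expN (s • Y) * b : G d) : Mat d) = (a : Mat d) * (b : Mat d) +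
      s • ((a : Mat d) * Y * (b : Mat d)) + (s ^ 2 / 2) • ((a : Mat d) * Y ^ 2 * (b : Mat d)) := by
    intro s
    change (a : Mat d) * NormedSpace.exp (s • (Y : Mat d)) * (b : Mat d) = _
    rw [exp_eq_of_cube_eq_zero (by rw [smul_pow, h3, smul_zero]), smul_pow, smul_smul]
    simp only [Matrix.mul_add, Matrix.add_mul, Matrix.mul_smul, Matrix.smul_mul, Matrix.mul_one]
    rw [one_div_mul_eq_div]
  rw [funext h]
  exact (contDiff_const.add (contDiff_id.smul contDiff_const)).add
    (((contDiff_id.pow 2).div_const 2).smul contDiff_const)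

variable {V : Type*} [NormedAddCommGroup V] [NormedSpace ℂ V]
  {σ : Representation ℂ (M u) V} {lam : lieA u →ₗ[ℝ] ℂ} {f : G d → V}

/-- The value of `lam + ρ` at the generator of `𝔞`. -/
def exponent (lam : lieA u →ₗ[ℝ] ℂ) : ℂ := lam (H₁ u) + (rho u (H₁ u) : ℂ)

lemma smoothSeries_expA_mul (hf : f ∈ smoothSeries σ lam) (t : ℝ) (x : G d) :
    f (expA (t • H₁ u) * x) = Complex.exp (exponent lam * t) • f x := by
  have h := hf.2 1 (t • H₁ u) 1 (expN_zero (u := u) ▸ expN_mem 0) x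
  simp only [Subgroup.coe_one, one_mul, mul_one, map_one, Module.End.one_apply] at h
  rw [h, exponent, map_smul, map_smul, Complex.real_smul, smul_eq_mul]
  congr 2
  push_cast
  ring

lemma smoothSeries_expN_mul (hf : f ∈ smoothSeries σ lam) (Y : lieN u) (x : G d) :
    f (expN Y * x) = f x := by
  simpa [expA_zero] using hf.2 1 0 (expN Y) (expN_mem Y) x

lemma smoothSeries_M_mul (hf : f ∈ smoothSeries σ lam) (m : M u) (x : G d) :
    f (m * x) = σ m (f x) := by
  simpa [expA_zero] using hf.2 m 0 1 (expN_zero (u := u) ▸ expN_mem 0) x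

variable [FiniteDimensional ℂ V]

lemma contDiff_dual_comp (hf : f ∈ smoothSeries σ lam) (hu : u ⬝ᵥ u = 1) (l : Module.Dual ℂ V)
    (a b : G d) (Y : lieN u) : ContDiff ℝ ∞ fun s : ℝ => l (f (a * expN (s • Y) * b)) := by
  have h1 := hf.1.contDiff_comp (contDiff_mul_expN_mul hu a b Y)
  exact (l.toContinuousLinearMap.restrictScalars ℝ).contDiff.comp h1

lemma hasExpTails_orbit (hf : f ∈ smoothSeries σ lam) (hu : u ⬝ᵥ u = 1) (l : Module.Dual ℂ V)
    {w : G d} (hw : IsWeylRep u w) {Y : lieN u} (hY : Y ≠ 0) :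
    HasExpTails (exponent lam) fun t : ℝ => l (f (w * expN Y * expA (t • H₁ u))) := by
  refine ⟨⟨_, contDiff_dual_comp hf hu l w 1 Y, fun t => ?_⟩, ?_⟩
  · beta_reduce
    rw [mul_one, mul_assoc, expN_mul_expA, ← mul_assoc, hw.mul_expA hu, mul_assoc,
      smoothSeries_expA_mul hf, map_smul, smul_eq_mul, Complex.ofReal_neg, mul_neg, neg_mul]
  · obtain ⟨r, Y₁, Y₂, m, h⟩ := exists_bruhat hu hw hY
    refine ⟨_, (contDiff_const (c := Complex.exp (exponent lam * r))).mul
      (contDiff_dual_comp hf hu (l ∘ₗ σ m) w w⁻¹ Y₂), fun t => ?_⟩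
    have hwi : w⁻¹ * expA (t • H₁ u) = expA (-t • H₁ u) * w⁻¹ := by
      rw [inv_mul_eq_iff_eq_mul, ← mul_assoc, hw.mul_expA hu, neg_neg,
        mul_inv_cancel_right]
    -- Passing `exp(tH₁)` through `w⁻¹`, `expN Y₂` and `w` inverts it twice, so it emerges with its
    -- original sign, while `Y₂` is scaled by `e^t`. The left factors act through `a^(λ+ρ)` and `σ
    -- m`.
    have e : w * expN Y * expA (t • H₁ u) = expA (r • H₁ u) * (expN Y₁ * (m *
        (expA (t • H₁ u) * (w * expN (Real.exp t • Y₂) * w⁻¹)))) := by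
      have e1 := expN_mul_expA Y₂ (-t)
      have e2 := hw.mul_expA hu (-t)
      rw [neg_neg] at e1 e2
      rw [h]
      simp only [mul_assoc]
      rw [hwi, ← mul_assoc (expN Y₂), e1, ← mul_assoc w, ← mul_assoc w, e2]
      simp only [mul_assoc]
    beta_reduce
    rw [e, smoothSeries_expA_mul hf, smoothSeries_expN_mul hf, smoothSeries_M_mul hf,
      smoothSeries_expA_mul hf]
    simp only [map_smul, smul_eq_mul, LinearMap.comp_apply]
    ring

end

/-- `ad H₁` is the identity on `𝔫`, so the value is half of `dim 𝔫`. -/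
lemma rho_H₁_pos {d : ℕ} {u : Fin d → ℝ} [Nontrivial (lieN u)] : 0 < rho u (H₁ u) := by
  have h1 : adN u (H₁ u) = LinearMap.id := LinearMap.ext fun Y => Subtype.ext Y.2.2
  rw [rho, LinearMap.smul_apply, LinearMap.comp_apply, h1, LinearMap.trace_id, smul_eq_mul]
  have : 0 < Module.finrank ℝ (lieN u) := Module.finrank_pos
  positivity

end HypFourier

end

/-! ### The integrals as Fourier coefficients. -/

theorem mainTheorem6 {d : ℕ} (hd : 2 ≤ d)
    (u : Fin d → ℝ) (hu : ∑ i, u i ^ 2 = 1)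
    (γ x : HypFourier.G d) (Xγ : HypFourier.lieA u) (mγ : HypFourier.M u)
    (hγ : γ = x * (HypFourier.expA Xγ * mγ) * x⁻¹) (hXγ : HypFourier.expA Xγ ≠ 1)
    (lamγ : HypFourier.lieA u →ₗ[ℝ] ℂ)
    (hlamγ : lamγ Xγ = 2 * (Real.pi : ℂ) * Complex.I)
    (w₀ : HypFourier.G d) (hw₀ : HypFourier.IsWeylRep u w₀)
    (n₀ : HypFourier.G d) (hn₀ : n₀ ∈ HypFourier.N u) (hn₀' : n₀ ≠ 1)
    {V : Type*} [NormedAddCommGroup V] [NormedSpace ℂ V] [FiniteDimensional ℂ V]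
    (σ : Representation ℂ (HypFourier.M u) V) (hσ : σ.IsIrreducible)
    (hσc : ∀ v : V, Continuous fun m : HypFourier.M u => σ m v)
    (lam : HypFourier.lieA u →ₗ[ℝ] ℂ)
    (hlam : HypFourier.PosOnA u (Complex.reLm ∘ₗ lam + HypFourier.rho u))
    (l : Module.Dual ℂ V) (f : HypFourier.G d → V) (hf : f ∈ HypFourier.smoothSeriesM σ lam) :
    (∀ k : ℤ, MeasureTheory.Integrable (HypFourier.integrand lamγ w₀ n₀ k l f)) ∧
      HypFourier.RapidlyDecreasing fun k : ℤ => HypFourier.I lamγ w₀ n₀ k l f := by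
  open HypFourier in
  have hu' : u ⬝ᵥ u = 1 := by rw [← hu]; simp only [dotProduct, pow_two]
  obtain ⟨Y', hY', rfl⟩ := hn₀
  set Y : lieN u := ⟨Y', hY'⟩
  have hY : Y ≠ 0 := fun h => hn₀' (by rw [← expN_zero (u := u), ← h]; rfl)
  have : Nontrivial (lieN u) := ⟨Y, 0, hY⟩
  have hz : 0 < (exponent lam).re := by
    obtain ⟨t, ht, e⟩ := hlam
    have h := LinearMap.congr_fun e (H₁ u)
    have h' : (exponent lam).re = t * rho u (H₁ u) := by
      simpa [exponent] using h
    rw [h']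
    exact mul_pos ht rho_H₁_pos
  obtain ⟨r, rfl⟩ := exists_expA_eq Xγ
  have hr : r ≠ 0 := by
    rintro rfl
    rw [zero_smul, map_zero] at hlamγ
    exact Complex.two_pi_I_ne_zero hlamγ.symm
  -- Here `r` is the signed translation length of `γ`, and `a^(-kλ_γ)` becomes the character of
  -- frequency `k / r`.
  have hl : lamγ (H₁ u) = 2 * Real.pi * Complex.I * (r⁻¹ : ℝ) := by
    rw [map_smul, Complex.real_smul] at hlamγ
    rw [← hlamγ, Complex.ofReal_inv]
    have : (r : ℂ) ≠ 0 := by exact_mod_cast hr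
    field_simp
  have hF := hasExpTails_orbit hf.1 hu' l hw₀ hY
  have hI : ∀ k : ℤ, integrand lamγ w₀ (expG Y') k l f = fun t : ℝ =>
      l (f (w₀ * expN Y * expA (t • H₁ u))) *
        Complex.exp (-(k : ℂ) * (t * (2 * Real.pi * Complex.I * (r⁻¹ : ℝ)))) := fun k => by
    funext t
    rw [integrand, map_smul, hl, Complex.real_smul]
    rfl
  refine ⟨fun k => ?_, ?_⟩
  · rw [hI]
    exact hF.integrable_twist hz k r⁻¹
  · have h := hF.rapidlyDecreasing hz (inv_ne_zero hr)
    simpa only [I, hI] using h
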